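/- **Lemma (semigroups with nonempty interior).** Let $G$ be a closed subgroup of $\mathrm{GL}(n,\mathbb{R})$ which is semisimple, i.e. whose Lie algebra $\mathfrak{g} = \{X \in M_n(\mathbb{R}) : \exp(tX) \in G \text{ for all } t \in \mathbb{R}\}$ is semisimple. (For instance, $G$ may be the group of real points of a connected semisimple linear algebraic group defined over $\mathbb{R}$, or a connected semisimple linear real Lie group.) Let $\gamma_1, \dots, \gamma_s : \mathbb{R} \to G$ be one-parameter subgroups, i.e. continuous homomorphisms, and let $H$ be the subsemigroup of $G$ generated by the sets $\gamma_j([1,\infty))$, $1 \le j \le s$. Suppose that $H$ is Zariski-dense in $G$, i.e. every polynomial in the matrix entries that vanishes on $H$ vanishes on $G$. Then $H$ has nonempty interior in $G$. -/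

import Mathlib

open scoped Topology

section BanachAlgebra

open Filter

variable {R : Type*} [NormedRing R] [NormedAlgebra ℝ R]

/-- The set of all `X` whose one-parameter group `t ↦ exp (t X)` is contained in the group `G`
of units. -/
def expTangentSet {R : Type*} [Ring R] [TopologicalSpace R] [IsTopologicalRing R] [Algebra ℝ R]
    (G : Subgroup Rˣ) : Set R :=
  {X | ∀ t : ℝ, ∃ g ∈ G, (g : R) = NormedSpace.exp (t • X)}

theorem norm_pow_sub_pow_le_of_bound {R : Type*} [NormedRing R] [NormOneClass R] (a b : R) (M : ℝ) (hM : 1 ≤ M)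
    (ha : ‖a‖ ≤ M) (hb : ‖b‖ ≤ M) (k : ℕ) : ‖a ^ k - b ^ k‖ ≤ k * M ^ k * ‖a - b‖ := by
  have hM0 : (0 : ℝ) ≤ M := by linarith
  induction k with
  | zero => simp
  | succ k ih =>
    have e : a ^ (k + 1) - b ^ (k + 1) = a ^ k * (a - b) + (a ^ k - b ^ k) * b := by
      rw [pow_succ, pow_succ]; noncomm_ring
    have h1 : ‖a ^ k * (a - b)‖ ≤ M ^ (k + 1) * ‖a - b‖ := by
      refine (norm_mul_le _ _).trans (mul_le_mul_of_nonneg_right ?_ (norm_nonneg _))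
      exact ((norm_pow_le a k).trans (pow_le_pow_left₀ (norm_nonneg _) ha k)).trans
        (pow_le_pow_right₀ hM (Nat.le_succ k))
    have h2 : ‖(a ^ k - b ^ k) * b‖ ≤ k * M ^ (k + 1) * ‖a - b‖ := by
      calc ‖(a ^ k - b ^ k) * b‖ ≤ ‖a ^ k - b ^ k‖ * ‖b‖ := norm_mul_le _ _
        _ ≤ (k * M ^ k * ‖a - b‖) * M :=
          mul_le_mul ih hb (norm_nonneg _) (by positivity)
        _ = k * M ^ (k + 1) * ‖a - b‖ := by ring
    rw [e]
    refine (norm_add_le _ _).trans ((add_le_add h1 h2).trans (le_of_eq ?_))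
    push_cast; ring

theorem tendsto_pow_exp_of_hasDerivAt [CompleteSpace R] [NormOneClass R] (f : ℝ → R) (Z : R)
    (hf : HasDerivAt f Z 0) (hf0 : f 0 = 1) :
    Tendsto (fun n : ℕ => f (1 / ((n : ℝ) + 1)) ^ (n + 1)) atTop (𝓝 (NormedSpace.exp Z)) := by
  set g : ℝ → R := fun s => NormedSpace.exp (s • Z) with hg
  have hgd : HasDerivAt g Z 0 := by
    simpa using hasDerivAt_exp_smul_const (𝕂 := ℝ) Z 0
  have hg0 : g 0 = 1 := by simp [hg]
  have hs : Tendsto (fun n : ℕ => 1 / ((n : ℝ) + 1)) atTop (𝓝 0) :=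
    tendsto_one_div_add_atTop_nhds_zero_nat
  have hgpow : ∀ n : ℕ, g (1 / ((n : ℝ) + 1)) ^ (n + 1) = NormedSpace.exp Z := by
    intro n
    have hn : ((n : ℝ) + 1) ≠ 0 := by positivity
    let _ : NormedAlgebra ℚ R := NormedAlgebra.restrictScalars ℚ ℝ R
    rw [hg]
    simp only
    rw [← NormedSpace.exp_nsmul, ← Nat.cast_smul_eq_nsmul ℝ, smul_smul]
    push_cast
    rw [mul_one_div_cancel hn, one_smul]
  have bound : ∀ F : ℝ → R, HasDerivAt F Z 0 → F 0 = 1 →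
      ∀ᶠ n : ℕ in atTop, ‖F (1 / ((n : ℝ) + 1))‖ ≤ 1 + (‖Z‖ + 1) * (1 / ((n : ℝ) + 1)) := by
    intro F hF hF0
    have h := (hasDerivAt_iff_isLittleO_nhds_zero.1 hF).bound (c := 1) one_pos
    filter_upwards [hs.eventually h] with n hn
    have hpos : (0 : ℝ) ≤ 1 / ((n : ℝ) + 1) := by positivity
    set r := 1 / ((n : ℝ) + 1)
    rw [zero_add, hF0, Real.norm_of_nonneg hpos] at hn
    have e : F r = (F r - 1 - r • Z) + 1 + r • Z := by abel
    calc ‖F r‖ = ‖(F r - 1 - r • Z) + 1 + r • Z‖ := by rw [← e]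
      _ ≤ ‖F r - 1 - r • Z‖ + ‖(1 : R)‖ + ‖r • Z‖ := norm_add₃_le
      _ ≤ 1 * r + 1 + r * ‖Z‖ := by
        rw [norm_smul, Real.norm_of_nonneg hpos, norm_one]; gcongr
      _ = 1 + (‖Z‖ + 1) * r := by ring
  have hdiff : Tendsto (fun n : ℕ => ((n : ℝ) + 1) *
      ‖f (1 / ((n : ℝ) + 1)) - g (1 / ((n : ℝ) + 1))‖) atTop (𝓝 0) := by
    have h := hasDerivAt_iff_isLittleO_nhds_zero.1 (hf.sub hgd)
    rw [Metric.tendsto_atTop]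
    intro ε hε
    have h' := hs.eventually (h.bound (c := ε / 2) (by positivity))
    obtain ⟨N, hN⟩ := eventually_atTop.1 h'
    refine ⟨N, fun n hn => ?_⟩
    have hh := hN n hn
    have hp : (0 : ℝ) < (n : ℝ) + 1 := by positivity
    simp only [zero_add, Pi.sub_apply, hf0, hg0, sub_self, sub_zero, smul_zero] at hh
    rw [Real.norm_of_nonneg (by positivity : (0 : ℝ) ≤ 1 / ((n : ℝ) + 1))] at hh
    rw [Real.dist_0_eq_abs, abs_of_nonneg (by positivity)]
    calc _ ≤ ((n : ℝ) + 1) * (ε / 2 * (1 / ((n : ℝ) + 1))) :=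
          mul_le_mul_of_nonneg_left hh hp.le
      _ = ε / 2 := by field_simp
      _ < ε := by linarith
  rw [tendsto_iff_norm_sub_tendsto_zero]
  have hlim : Tendsto (fun n : ℕ => Real.exp (‖Z‖ + 1) * (((n : ℝ) + 1) *
      ‖f (1 / ((n : ℝ) + 1)) - g (1 / ((n : ℝ) + 1))‖)) atTop (𝓝 0) := by
    simpa using hdiff.const_mul (Real.exp (‖Z‖ + 1))
  refine squeeze_zero' (Eventually.of_forall fun n => norm_nonneg _) ?_ hlim
  filter_upwards [bound f hf hf0, bound g hgd hg0] with n h1 h2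
  have hp : (0 : ℝ) < (n : ℝ) + 1 := by positivity
  rw [← hgpow n]
  set M : ℝ := 1 + (‖Z‖ + 1) * (1 / ((n : ℝ) + 1)) with hMdef
  have hM : 1 ≤ M := by
    have : 0 ≤ (‖Z‖ + 1) * (1 / ((n : ℝ) + 1)) := by positivity
    linarith
  have hMp : M ^ (n + 1) ≤ Real.exp (‖Z‖ + 1) := by
    have h3 : M ≤ Real.exp ((‖Z‖ + 1) * (1 / ((n : ℝ) + 1))) := by
      have := Real.add_one_le_exp ((‖Z‖ + 1) * (1 / ((n : ℝ) + 1)))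
      linarith
    calc M ^ (n + 1) ≤ Real.exp ((‖Z‖ + 1) * (1 / ((n : ℝ) + 1))) ^ (n + 1) :=
          pow_le_pow_left₀ (by linarith) h3 _
      _ = Real.exp (‖Z‖ + 1) := by
        rw [← Real.exp_nat_mul]
        congr 1
        push_cast
        field_simp
  refine (norm_pow_sub_pow_le_of_bound _ _ M hM h1 h2 (n + 1)).trans ?_
  push_cast
  calc _ = M ^ (n + 1) * (((n : ℝ) + 1) *
        ‖f (1 / ((n : ℝ) + 1)) - g (1 / ((n : ℝ) + 1))‖) := by ring
    _ ≤ _ := mul_le_mul_of_nonneg_right hMp (by positivity)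

theorem expTangentSet_zero_mem (G : Subgroup Rˣ) : (0 : R) ∈ expTangentSet G :=
  fun t => ⟨1, G.one_mem, by simp⟩

theorem expTangentSet_smul_mem (G : Subgroup Rˣ) (c : ℝ) {X : R} (hX : X ∈ expTangentSet G) :
    c • X ∈ expTangentSet G := by
  intro t
  rw [smul_smul]
  exact hX (t * c)

theorem expTangentSet_add_mem [CompleteSpace R] [NormOneClass R] (G : Subgroup Rˣ) (hG : IsClosed (G : Set Rˣ))
    {X Y : R} (hX : X ∈ expTangentSet G) (hY : Y ∈ expTangentSet G) :
    X + Y ∈ expTangentSet G := by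
  intro t
  let _ : NormedAlgebra ℚ R := NormedAlgebra.restrictScalars ℚ ℝ R
  choose a ha ha' using expTangentSet_smul_mem G t hX
  choose b hb hb' using expTangentSet_smul_mem G t hY
  obtain ⟨z, hz⟩ := NormedSpace.isUnit_exp (t • (X + Y))
  refine ⟨z, ?_, hz⟩
  have hd : HasDerivAt (fun s : ℝ => NormedSpace.exp (s • (t • X)) * NormedSpace.exp (s • (t • Y)))
      (t • (X + Y)) 0 := by
    refine ((hasDerivAt_exp_smul_const (𝕂 := ℝ) (t • X) 0).fun_mul
      (hasDerivAt_exp_smul_const (𝕂 := ℝ) (t • Y) 0)).congr_deriv ?_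
    simp [smul_add]
  have hlim := tendsto_pow_exp_of_hasDerivAt _ _ hd (by simp)
  have hlim' : Tendsto (fun n : ℕ => (a (1 / ((n : ℝ) + 1)) * b (1 / ((n : ℝ) + 1))) ^ (n + 1))
      atTop (𝓝 z) := by
    rw [(Units.isOpenEmbedding_val (R := R)).isInducing.tendsto_nhds_iff, hz]
    refine hlim.congr fun n => ?_
    simp only [Function.comp_apply, Units.val_pow_eq_pow_val, Units.val_mul, ha', hb']
  exact hG.mem_of_tendsto hlim' (Eventually.of_forall fun n =>
    G.pow_mem (G.mul_mem (ha _) (hb _)) _)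

theorem expTangentSet_conj_mem [CompleteSpace R] (G : Subgroup Rˣ) {g : Rˣ} (hg : g ∈ G) {Y : R}
    (hY : Y ∈ expTangentSet G) : (g : R) * Y * ((g⁻¹ : Rˣ) : R) ∈ expTangentSet G := by
  intro t
  let _ : NormedAlgebra ℚ R := NormedAlgebra.restrictScalars ℚ ℝ R
  obtain ⟨y, hy, hy'⟩ := hY t
  refine ⟨g * y * g⁻¹, G.mul_mem (G.mul_mem hg hy) (G.inv_mem hg), ?_⟩
  rw [Units.val_mul, Units.val_mul, hy', ← NormedSpace.exp_units_conj]
  congr 1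
  rw [mul_smul_comm, smul_mul_assoc]

theorem expTangentSet_lie_mem [CompleteSpace R] [NormOneClass R] [FiniteDimensional ℝ R] (G : Subgroup Rˣ)
    (hG : IsClosed (G : Set Rˣ)) {X Y : R} (hX : X ∈ expTangentSet G)
    (hY : Y ∈ expTangentSet G) : X * Y - Y * X ∈ expTangentSet G := by
  let _ : NormedAlgebra ℚ R := NormedAlgebra.restrictScalars ℚ ℝ R
  let V : Submodule ℝ R :=
    { carrier := expTangentSet G
      zero_mem' := expTangentSet_zero_mem G
      add_mem' := fun h h' => expTangentSet_add_mem G hG h h'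
      smul_mem' := fun c _ h => expTangentSet_smul_mem G c h }
  have hV : IsClosed (V : Set R) := V.closed_of_finiteDimensional
  have hmem : ∀ s : ℝ, NormedSpace.exp (s • X) * Y * NormedSpace.exp (s • (-X)) ∈ V := by
    intro s
    obtain ⟨g, hg, hg'⟩ := hX s
    have hinv : ((g⁻¹ : Rˣ) : R) = NormedSpace.exp (s • (-X)) := by
      refine Units.inv_eq_of_mul_eq_one_right ?_
      rw [hg', smul_neg, ← NormedSpace.exp_add_of_commute (Commute.neg_right (Commute.refl _)),
        add_neg_cancel, NormedSpace.exp_zero]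
    have := expTangentSet_conj_mem G hg hY
    rw [hg', hinv] at this
    exact this
  have hd : HasDerivAt (fun s : ℝ => NormedSpace.exp (s • X) * Y * NormedSpace.exp (s • (-X)))
      (X * Y - Y * X) 0 := by
    refine (((hasDerivAt_exp_smul_const (𝕂 := ℝ) X 0).mul_const Y).fun_mul
      (hasDerivAt_exp_smul_const (𝕂 := ℝ) (-X) 0)).congr_deriv ?_
    simp [sub_eq_add_neg]
  refine hV.mem_of_tendsto (hasDerivAt_iff_tendsto_slope.1 hd) (Eventually.of_forall fun s => ?_)
  exact V.smul_mem _ (V.sub_mem (hmem s) (hmem 0))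

end BanachAlgebra

section LinearGroups

open Matrix

attribute [local instance 100] LieRing.ofAssociativeRing

/-- The Lie algebra of a closed subgroup `G` of `GL(n, ℝ)`: the matrices `X` such that
`exp (t X) ∈ G` for every real `t`, with the commutator bracket. -/
def lieAlgebraOfClosedSubgroup {n : ℕ} (G : Subgroup (GL (Fin n) ℝ))
    (hG : IsClosed (G : Set (GL (Fin n) ℝ))) :
    LieSubalgebra ℝ (Matrix (Fin n) (Fin n) ℝ) where
  carrier := {X | ∀ t : ℝ, ∃ g ∈ G, (g : Matrix (Fin n) (Fin n) ℝ) = NormedSpace.exp (t • X)}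
  zero_mem' := fun t => ⟨1, G.one_mem, by simp⟩
  add_mem' := by
    intro X Y hX hY
    rcases isEmpty_or_nonempty (Fin n) with h | h
    · exact fun t => ⟨1, G.one_mem, Subsingleton.elim _ _⟩
    · letI := Matrix.linftyOpNormedRing (n := Fin n) (α := ℝ)
      let _ := Matrix.linftyOpNormedAlgebra (n := Fin n) (α := ℝ) (R := ℝ)
      exact expTangentSet_add_mem G hG hX hY
  smul_mem' := by
    intro c X hX t
    rw [smul_smul]
    exact hX (t * c)
  lie_mem' := by
    intro X Y hX hY
    rcases isEmpty_or_nonempty (Fin n) with h | h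
    · exact fun t => ⟨1, G.one_mem, Subsingleton.elim _ _⟩
    · letI := Matrix.linftyOpNormedRing (n := Fin n) (α := ℝ)
      let _ := Matrix.linftyOpNormedAlgebra (n := Fin n) (α := ℝ) (R := ℝ)
      exact expTangentSet_lie_mem G hG hX hY

/-- A subset `S` of a linear group `G` is Zariski-dense in `G` if every polynomial in the matrix
entries which vanishes on `S` vanishes on all of `G`. -/
def IsZariskiDense {n : ℕ} (G : Subgroup (GL (Fin n) ℝ)) (S : Set G) : Prop :=
  ∀ p : MvPolynomial (Fin n × Fin n) ℝ,
    (∀ g ∈ S, MvPolynomial.eval (fun ij => (g : GL (Fin n) ℝ) ij.1 ij.2) p = 0) →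
    ∀ g : G, MvPolynomial.eval (fun ij => (g : GL (Fin n) ℝ) ij.1 ij.2) p = 0

/-- The semigroup generated by the half-lines `γ j ([1, ∞))`, where the `γ j` are one-parameter
subgroups, that is, continuous homomorphisms from `(ℝ, +)` to `G`. -/
def halfLineSemigroup {G : Type*} [Group G] [TopologicalSpace G] {s : ℕ}
    (γ : Fin s → (Multiplicative ℝ →ₜ* G)) : Subsemigroup G :=
  Subsemigroup.closure (⋃ j, (fun t : ℝ => γ j (Multiplicative.ofAdd t)) '' Set.Ici 1)

end LinearGroups

/-! ### One-parameter semigroups are exponentials; tangent directions of a closed group. -/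

section OneParameter

open Filter

variable {R : Type*} [NormedRing R] [NormedAlgebra ℝ R] [CompleteSpace R]

/-! Write `γ j` as `t ↦ exp (t X j)`. Among all points `g` of `H` and all subspaces `W` of
directions in which `H` contains a smooth plot through `g` (`IsTangentAt`), take `W` of maximal
dimension. Multiplying a plot on the right by `h ∈ H` and by `exp (t X j)` with `t` near 2 adds the
direction `(gh) X j (gh)⁻¹`, so by maximality `W` already contains it. This is a polynomial
condition on `h` up to a power of the determinant, so Zariski density gives `h X j h⁻¹ ∈ W` for
every `h ∈ G`.

The tangent vectors whose whole `G`-conjugacy orbit lies in `W` form an ideal `I` of the Lie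
algebra, and `I` contains every `X j`. By semisimplicity `I` has a complementary ideal, which
commutes with `I`, hence with `H`, hence with `G` by density. It is therefore central, so zero
(`IsZariskiDense.eq_top_of_lieIdeal`). Thus `W` contains the whole Lie algebra, and an open mapping
argument (`IsTangentAt.eventually_mem`) shows that `H` is a neighbourhood of `g` in `G`. -/

theorem val_zpow_of_eq_exp {u : Rˣ} {Y : R} (hu : (u : R) = NormedSpace.exp Y) (k : ℤ) :
    ((u ^ k : Rˣ) : R) = NormedSpace.exp ((k : ℝ) • Y) := by
  let _ : NormedAlgebra ℚ R := NormedAlgebra.restrictScalars ℚ ℝ R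
  have hn : ∀ j : ℕ, ((u ^ j : Rˣ) : R) = NormedSpace.exp ((j : ℝ) • Y) := fun j => by
    rw [Units.val_pow_eq_pow_val, hu, ← NormedSpace.exp_nsmul, Nat.cast_smul_eq_nsmul]
  obtain ⟨j, rfl | rfl⟩ := k.eq_nat_or_neg
  · simpa using hn j
  · rw [zpow_neg, zpow_natCast]
    refine Units.inv_eq_of_mul_eq_one_right ?_
    rw [hn, Int.cast_neg, Int.cast_natCast, neg_smul,
      ← NormedSpace.exp_add_of_commute (Commute.neg_right (Commute.refl _)),
      add_neg_cancel, NormedSpace.exp_zero]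

/-- A direction which is a limit of directions `Yₖ / ‖Yₖ‖` with `Yₖ → 0` and `exp Yₖ ∈ G` is tangent
to the closed group `G`. -/
theorem mem_expTangentSet_of_tendsto (G : Subgroup Rˣ) (hG : IsClosed (G : Set Rˣ))
    {y : ℕ → R} {Z : R} (hy : Tendsto y atTop (𝓝 0)) (hy0 : ∀ k, y k ≠ 0)
    (hyG : ∀ k, ∃ g ∈ G, (g : R) = NormedSpace.exp (y k))
    (hZ : Tendsto (fun k => ‖y k‖⁻¹ • y k) atTop (𝓝 Z)) : Z ∈ expTangentSet G := by
  intro t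
  let _ : NormedAlgebra ℚ R := NormedAlgebra.restrictScalars ℚ ℝ R
  choose u huG hu using hyG
  obtain ⟨z, hz⟩ := NormedSpace.isUnit_exp (t • Z)
  refine ⟨z, ?_, hz⟩
  have hn : Tendsto (fun k => ‖y k‖) atTop (𝓝 0) := by simpa using hy.norm
  -- Integer multiples of `y k` exponentiate into `G`. Their spacing `‖y k‖` tends to 0, so suitable
  -- ones approximate `t • Z`.
  have hc : Tendsto (fun k => (⌊t / ‖y k‖⌋ : ℝ) * ‖y k‖) atTop (𝓝 t) := by
    rw [tendsto_iff_norm_sub_tendsto_zero]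
    refine squeeze_zero (fun _ => norm_nonneg _) (fun k => ?_) hn
    have hp : 0 < ‖y k‖ := norm_pos_iff.2 (hy0 k)
    have h1 := Int.floor_le (t / ‖y k‖)
    have h2 := Int.lt_floor_add_one (t / ‖y k‖)
    rw [le_div_iff₀ hp] at h1
    rw [div_lt_iff₀ hp, add_mul, one_mul] at h2
    rw [Real.norm_eq_abs, abs_le]
    constructor <;> linarith
  have hlim : Tendsto (fun k => (⌊t / ‖y k‖⌋ : ℝ) • y k) atTop (𝓝 (t • Z)) := by
    refine (hc.smul hZ).congr fun k => ?_
    rw [smul_smul, mul_assoc, mul_inv_cancel₀ (norm_ne_zero_iff.2 (hy0 k)), mul_one]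
  have hlim' : Tendsto (fun k => u k ^ ⌊t / ‖y k‖⌋) atTop (𝓝 z) := by
    rw [(Units.isOpenEmbedding_val (R := R)).isInducing.tendsto_nhds_iff, hz]
    refine ((NormedSpace.exp_continuous.tendsto _).comp hlim).congr fun k => ?_
    simp only [Function.comp_apply, val_zpow_of_eq_exp (hu k)]
  exact hG.mem_of_tendsto hlim' (Eventually.of_forall fun k => G.zpow_mem (huG k) _)

/-- Near `0`, a subspace transverse to the tangent space of the closed group `G` contains no nonzero
element whose exponential lies in `G`. -/
theorem eventually_eq_zero_of_exp_mem [FiniteDimensional ℝ R] (G : Subgroup Rˣ)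
    (hG : IsClosed (G : Set Rˣ)) (m : Submodule ℝ R)
    (hm : ∀ Y ∈ m, Y ∈ expTangentSet G → Y = 0) :
    ∀ᶠ Y in 𝓝 (0 : R), Y ∈ m → (∃ g ∈ G, (g : R) = NormedSpace.exp Y) → Y = 0 := by
  by_contra h
  obtain ⟨y, hy, hy'⟩ := exists_seq_forall_of_frequently (not_eventually.1 h)
  push Not at hy'
  have hproper : ProperSpace R := FiniteDimensional.proper ℝ R
  have hsph : ∀ k, ‖y k‖⁻¹ • y k ∈ Metric.sphere (0 : R) 1 := fun k => by
    rw [mem_sphere_zero_iff_norm, norm_smul, norm_inv, norm_norm,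
      inv_mul_cancel₀ (norm_ne_zero_iff.2 (hy' k).2.2)]
  obtain ⟨Z, hZ, φ, hφ, hlim⟩ := (isCompact_sphere (0 : R) 1).tendsto_subseq hsph
  have hZG : Z ∈ expTangentSet G :=
    mem_expTangentSet_of_tendsto G hG (hy.comp hφ.tendsto_atTop) (fun k => (hy' _).2.2)
      (fun k => (hy' _).2.1) hlim
  have hZm : Z ∈ m := m.closed_of_finiteDimensional.mem_of_tendsto hlim
    (Eventually.of_forall fun k => m.smul_mem _ (hy' _).1)
  rw [hm Z hZm hZG] at hZ
  simp at hZ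

/-- A continuous one-parameter semigroup in a Banach algebra is differentiable at the origin. -/
theorem exists_hasDerivAt_of_map_add (f : ℝ → R) (hf : Continuous f) (hf0 : f 0 = 1)
    (hadd : ∀ s t, f (s + t) = f s * f t) : ∃ X, HasDerivAt f X 0 := by
  have hint : ∀ a b, IntervalIntegrable f MeasureTheory.volume a b := hf.intervalIntegrable
  set I : ℝ → R := fun x => ∫ s in (0 : ℝ)..x, f s with hI
  have hId : ∀ x, HasDerivAt I (f x) x := fun x => hf.integral_hasStrictDerivAt 0 x |>.hasDerivAt
  have hslope : Tendsto (slope I 0) (𝓝[≠] 0) (𝓝 (1 : R)) :=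
    hf0 ▸ hasDerivAt_iff_tendsto_slope.1 (hId 0)
  have hunit : ∀ᶠ a in 𝓝[≠] (0 : ℝ), IsUnit (slope I 0 a) :=
    hslope.eventually (Units.isOpen.mem_nhds isUnit_one)
  obtain ⟨a, ha, ha0⟩ := (hunit.and self_mem_nhdsWithin).exists
  have haI : IsUnit (I a) := by
    have hIa : I a = a • slope I 0 a := by
      simp [slope_def_module, hI, smul_smul, mul_inv_cancel₀ (show a ≠ 0 from ha0)]
    rw [hIa, Algebra.smul_def]
    exact ((IsUnit.mk0 a ha0).map (algebraMap ℝ R)).mul ha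
  obtain ⟨u, hu⟩ := haI
  -- Integrate `f (t + s) = f t * f s` over `s` from 0 to `a`. Since `I a / a` is close to `f 0 =
  -- 1`, `I a` is invertible for a suitable `a`, so `f` inherits differentiability from its
  -- primitive.
  have hform : ∀ t, f t = (I (t + a) - I t) * ((u⁻¹ : Rˣ) : R) := by
    intro t
    rw [Units.eq_mul_inv_iff_mul_eq, hu, hI]
    simp only
    rw [intervalIntegral.integral_interval_sub_left (hint _ _) (hint _ _)]
    have h := (ContinuousLinearMap.mul ℝ R (f t)).intervalIntegral_comp_comm (hint 0 a)
    simp only [ContinuousLinearMap.mul_apply', ← hadd] at h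
    rw [← h, intervalIntegral.integral_comp_add_left]
    simp
  refine ⟨(f (0 + a) - f 0) * ((u⁻¹ : Rˣ) : R), ?_⟩
  exact ((((hId (0 + a)).comp_add_const 0 a).sub (hId 0)).mul_const _).congr_of_eventuallyEq
    (Eventually.of_forall hform)

/-- A continuous one-parameter semigroup in a Banach algebra is of the form `t ↦ exp (t X)`. -/
theorem exists_eq_exp_of_map_add [NormOneClass R] (f : ℝ → R) (hf : Continuous f) (hf0 : f 0 = 1)
    (hadd : ∀ s t, f (s + t) = f s * f t) :
    ∃ X : R, ∀ t : ℝ, f t = NormedSpace.exp (t • X) := by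
  obtain ⟨X, hX⟩ := exists_hasDerivAt_of_map_add f hf hf0 hadd
  refine ⟨X, fun t => ?_⟩
  have hpow : ∀ (r : ℝ) (k : ℕ), f r ^ k = f (k * r) := by
    intro r k
    induction k with
    | zero => simp [hf0]
    | succ k ih => rw [pow_succ, ih, ← hadd]; congr 1; push_cast; ring
  have hd : HasDerivAt (fun r => f (t * r)) (t • X) 0 := by
    have h0 : HasDerivAt f X (t * 0) := by simpa using hX
    have h1 : HasDerivAt (fun r : ℝ => t * r) t 0 := by
      simpa using (hasDerivAt_id (0 : ℝ)).const_mul t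
    exact h0.scomp (0 : ℝ) h1
  -- The sequence `f (t / (n + 1)) ^ (n + 1)` is constantly `f t`, and it converges to `exp (t X)`.
  refine tendsto_nhds_unique (Tendsto.congr (fun n => ?_) tendsto_const_nhds)
    (tendsto_pow_exp_of_hasDerivAt _ _ hd (by simp [hf0]))
  rw [hpow]
  congr 1
  have hn : ((n : ℝ) + 1) ≠ 0 := by positivity
  push_cast
  field_simp

end OneParameter


/-! ### Smooth plots in a subset of a linear group and their tangent directions. -/

section Plots

open Filter

variable {R : Type*} [NormedRing R] [NormedAlgebra ℝ R]

/-- Some map from a Banach space into `S` passes through `g`, is strictly differentiable there, and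
the range of its derivative, right-translated to the identity, contains `W`. -/
def IsTangentAt (S : Set Rˣ) (g : Rˣ) (W : Submodule ℝ R) : Prop :=
  ∃ (E : Type) (_ : NormedAddCommGroup E) (_ : NormedSpace ℝ E) (_ : CompleteSpace E)
    (F : E → R) (F' : E →L[ℝ] R), HasStrictFDerivAt F F' 0 ∧ F 0 = g ∧
    (∀ᶠ x in 𝓝 0, ∃ h ∈ S, (h : R) = F x) ∧ ∀ w ∈ W, ∃ e, F' e = w * g

namespace IsTangentAt

variable {S : Set Rˣ} {g h : Rˣ} {W : Submodule ℝ R}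

theorem mem (hW : IsTangentAt S g W) : g ∈ S := by
  obtain ⟨E, _, _, _, F, F', -, h0, hS, -⟩ := hW
  obtain ⟨k, hk, hk'⟩ := hS.self_of_nhds
  rwa [← Units.ext (hk'.trans h0)]

theorem bot (hg : g ∈ S) : IsTangentAt S g (⊥ : Submodule ℝ R) := by
  refine ⟨ℝ, inferInstance, inferInstance, inferInstance, fun _ => g, 0,
    hasStrictFDerivAt_const _ _, rfl, Eventually.of_forall fun _ => ⟨g, hg, rfl⟩, fun w hw => ?_⟩
  rw [Submodule.mem_bot] at hw
  exact ⟨0, by simp [hw]⟩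

/-- Directions are right-translated to the identity, so `(w * g) * h = w * (g * h)` leaves `W`
unchanged. -/
theorem mul_right (hS : ∀ a ∈ S, ∀ b ∈ S, a * b ∈ S) (hW : IsTangentAt S g W) (hh : h ∈ S) :
    IsTangentAt S (g * h) W := by
  obtain ⟨E, i₁, i₂, i₃, F, F', hF, h0, hFS, hFW⟩ := hW
  refine ⟨E, i₁, i₂, i₃, fun x => F x * h, _, hF.mul_const' (h : R), by simp [h0], ?_,
    fun w hw => ?_⟩
  · filter_upwards [hFS] with x ⟨k, hk, hk'⟩
    exact ⟨k * h, hS _ hk _ hh, by simp [hk']⟩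
  · obtain ⟨e, he⟩ := hFW w hw
    exact ⟨e, by simp [he, mul_assoc]⟩

/-- The product plot `(x, t) ↦ F x * exp ((t₀ + t) X)` has `t`-derivative `g X h = (g X g⁻¹) (g h)`
at the origin. This is how the tangent space grows. -/
theorem mul_exp [CompleteSpace R] (hS : ∀ a ∈ S, ∀ b ∈ S, a * b ∈ S) (hW : IsTangentAt S g W)
    {X : R} {t₀ : ℝ} (hX : ∀ᶠ t in 𝓝 t₀, ∃ k ∈ S, (k : R) = NormedSpace.exp (t • X))
    (hh : (h : R) = NormedSpace.exp (t₀ • X)) :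
    IsTangentAt S (g * h) (W ⊔ Submodule.span ℝ {(g : R) * X * ((g⁻¹ : Rˣ) : R)}) := by
  obtain ⟨E, i₁, i₂, i₃, F, F', hF, h0, hFS, hFW⟩ := hW
  have hexp : HasStrictFDerivAt (fun p : E × ℝ => NormedSpace.exp ((t₀ + p.2) • X))
      ((ContinuousLinearMap.toSpanSingleton ℝ (X * (h : R))).comp
        (ContinuousLinearMap.snd ℝ E ℝ)) 0 := by
    have h1 : HasStrictFDerivAt (fun p : E × ℝ => t₀ + p.2) (ContinuousLinearMap.snd ℝ E ℝ) 0 :=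
      hasStrictFDerivAt_snd.const_add t₀
    have h2 : HasStrictDerivAt (fun t : ℝ => NormedSpace.exp (t • X)) (X * (h : R))
        (t₀ + (0 : E × ℝ).2) := by
      simpa [hh] using hasStrictDerivAt_exp_smul_const' (𝕂 := ℝ) X t₀
    exact h2.hasStrictFDerivAt.comp (0 : E × ℝ) h1
  have hF1 : HasStrictFDerivAt (fun p : E × ℝ => F p.1) (F'.comp (ContinuousLinearMap.fst ℝ E ℝ))
      0 :=
    HasStrictFDerivAt.comp (g := F) (0 : E × ℝ) hF hasStrictFDerivAt_fst
  refine ⟨E × ℝ, inferInstance, inferInstance, inferInstance, _, _, hF1.mul' hexp,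
    by simp [h0, hh], ?_, fun w hw => ?_⟩
  · have e1 : ∀ᶠ p : E × ℝ in 𝓝 0, ∃ k ∈ S, (k : R) = F p.1 :=
      (continuous_fst.tendsto (0 : E × ℝ)).eventually hFS
    have hc : Tendsto (fun p : E × ℝ => t₀ + p.2) (𝓝 0) (𝓝 t₀) := by
      simpa using (continuous_const.add continuous_snd).tendsto (f := fun p : E × ℝ => t₀ + p.2) 0
    filter_upwards [e1, hc.eventually hX] with p ⟨k, hk, hk'⟩ ⟨l, hl, hl'⟩
    exact ⟨k * l, hS _ hk _ hl, by simp [hk', hl']⟩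
  · obtain ⟨w', hw', v, hv, rfl⟩ := Submodule.mem_sup.1 hw
    obtain ⟨c, rfl⟩ := Submodule.mem_span_singleton.1 hv
    obtain ⟨e, he⟩ := hFW w' hw'
    refine ⟨(e, c), ?_⟩
    simp [h0, he, add_mul, mul_assoc, hh, add_comm]

/-- If the tangent directions of `S ⊆ G` at `g` fill the tangent space of the closed group `G`, then
`S` contains a neighbourhood of `g` in `G`. -/
theorem eventually_mem [FiniteDimensional ℝ R] (hW : IsTangentAt S g W) (G : Subgroup Rˣ)
    (hG : IsClosed (G : Set Rˣ)) (hSG : S ⊆ G) (V : Submodule ℝ R)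
    (hV : (V : Set R) = expTangentSet G) (hVW : V ≤ W) :
    ∀ᶠ x in 𝓝 g, x ∈ G → x ∈ S := by
  have hcomplete : CompleteSpace R := FiniteDimensional.complete ℝ R
  obtain ⟨E, i₁, i₂, i₃, F, F', hF, h0, hFS, hFW⟩ := hW
  -- With `m` transverse to the Lie algebra, `(Y, x) ↦ exp Y * F x` has surjective derivative onto
  -- all of `R`. Openness can thus be obtained in `R`, without a manifold structure on `G`.
  obtain ⟨m, hVm⟩ := V.exists_isCompl
  have hm : ∀ Y ∈ m, Y ∈ expTangentSet G → Y = 0 := fun Y hY hYG =>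
    Submodule.disjoint_def.1 hVm.disjoint Y (by rwa [← SetLike.mem_coe, hV]) hY
  have hmc : CompleteSpace m := FiniteDimensional.complete ℝ m
  have hexp : HasStrictFDerivAt (fun p : m × E => NormedSpace.exp (p.1 : R))
      (m.subtypeL.comp (ContinuousLinearMap.fst ℝ m E)) 0 := by
    have h1 : HasStrictFDerivAt (NormedSpace.exp : R → R) (1 : R →L[ℝ] R)
        ((m.subtypeL.comp (ContinuousLinearMap.fst ℝ m E)) 0) := by
      simpa using hasStrictFDerivAt_exp_zero (𝕂 := ℝ) (𝔸 := R)
    exact h1.comp (0 : m × E) (m.subtypeL.comp (ContinuousLinearMap.fst ℝ m E)).hasStrictFDerivAt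
  have hF1 : HasStrictFDerivAt (fun p : m × E => F p.2) (F'.comp (ContinuousLinearMap.snd ℝ m E))
      0 :=
    HasStrictFDerivAt.comp (g := F) (0 : m × E) hF hasStrictFDerivAt_snd
  have hmul := hexp.mul' hF1
  have hmap := hmul.map_nhds_eq_of_surj (by
    rw [LinearMap.range_eq_top]
    intro z
    obtain ⟨v, hv, y, hy, hvy⟩ := Submodule.mem_sup.1
      (hVm.sup_eq_top ▸ Submodule.mem_top : z * ((g⁻¹ : Rˣ) : R) ∈ V ⊔ m)
    obtain ⟨e, he⟩ := hFW v (hVW hv)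
    refine ⟨(⟨y, hy⟩, e), ?_⟩
    simp [h0, he, ← add_mul, hvy])
  simp only [Pi.mul_apply, Prod.fst_zero, Prod.snd_zero, ZeroMemClass.coe_zero,
    NormedSpace.exp_zero, one_mul, h0] at hmap
  have e1 : ∀ᶠ p : m × E in 𝓝 0, ∃ k ∈ S, (k : R) = F p.2 :=
    (continuous_snd.tendsto (0 : m × E)).eventually hFS
  have hc : Tendsto (fun p : m × E => (p.1 : R)) (𝓝 0) (𝓝 0) := by
    simpa using (continuous_subtype_val.comp continuous_fst).tendsto
      (f := fun p : m × E => (p.1 : R)) 0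
  have key : ∀ᶠ p : m × E in 𝓝 0, ∀ x : Rˣ, (x : R) = NormedSpace.exp (p.1 : R) * F p.2 →
      x ∈ G → x ∈ S := by
    filter_upwards [e1, hc.eventually (eventually_eq_zero_of_exp_mem G hG m hm)]
      with p ⟨k, hk, hk'⟩ hp x hx hxG
    -- If `x = exp Y * k` with `x, k ∈ G`, then `exp Y ∈ G`. Since `Y ∈ m` is small it vanishes, and
    -- `x = k ∈ S`.
    have hp0 := hp p.1.2 ⟨x * k⁻¹, G.mul_mem hxG (G.inv_mem (hSG hk)), by
      rw [Units.val_mul, Units.mul_inv_eq_iff_eq_mul, hx, hk']⟩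
    rw [hp0, NormedSpace.exp_zero, one_mul, ← hk'] at hx
    rwa [Units.ext hx]
  have key' : ∀ᶠ y in 𝓝 (g : R), ∀ x : Rˣ, (x : R) = y → x ∈ G → x ∈ S := by
    rw [← hmap, eventually_map]
    exact key
  exact (Units.continuous_val.tendsto g).eventually key' |>.mono fun x hx => hx x rfl

end IsTangentAt

theorem Submodule.mem_of_hasDerivAt {F : Type*} [NormedAddCommGroup F] [NormedSpace ℝ F]
    [FiniteDimensional ℝ F] (V : Submodule ℝ F) {f : ℝ → F} {f' : F} {x : ℝ}
    (hf : HasDerivAt f f' x) (hV : ∀ s, f s ∈ V) : f' ∈ V :=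
  V.closed_of_finiteDimensional.mem_of_tendsto (hasDerivAt_iff_tendsto_slope.1 hf)
    (Eventually.of_forall fun s => V.smul_mem _ (V.sub_mem (hV s) (hV x)))

theorem mem_of_exp_smul_mem [FiniteDimensional ℝ R] (V : Submodule ℝ R) {X : R}
    (h : ∀ s : ℝ, NormedSpace.exp (s • X) ∈ V) : X ∈ V := by
  have hcomplete : CompleteSpace R := FiniteDimensional.complete ℝ R
  exact V.mem_of_hasDerivAt (by simpa using hasDerivAt_exp_smul_const (𝕂 := ℝ) X 0) h

/-- A subspace stable under conjugation by `G` is stable under the bracket with elements tangent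
to `G`. -/
theorem lie_mem_of_conj_mem [FiniteDimensional ℝ R] (G : Subgroup Rˣ) (V : Submodule ℝ R)
    (hV : ∀ g ∈ G, ∀ Y ∈ V, (g : R) * Y * ((g⁻¹ : Rˣ) : R) ∈ V) {X Y : R}
    (hX : X ∈ expTangentSet G) (hY : Y ∈ V) : X * Y - Y * X ∈ V := by
  have hcomplete : CompleteSpace R := FiniteDimensional.complete ℝ R
  have hd : HasDerivAt (fun s : ℝ => NormedSpace.exp (s • X) * Y * NormedSpace.exp (s • (-X)))
      (X * Y - Y * X) 0 := by
    refine (((hasDerivAt_exp_smul_const (𝕂 := ℝ) X 0).mul_const Y).fun_mul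
      (hasDerivAt_exp_smul_const (𝕂 := ℝ) (-X) 0)).congr_deriv ?_
    simp [sub_eq_add_neg]
  refine V.mem_of_hasDerivAt hd fun s => ?_
  obtain ⟨g, hg, hg'⟩ := hX s
  have hinv : ((g⁻¹ : Rˣ) : R) = NormedSpace.exp (s • (-X)) := by
    have hone : (g : R) = NormedSpace.exp (s • X) := hg'
    simpa using val_zpow_of_eq_exp hone (-1)
  rw [← hg', ← hinv]
  exact hV g hg Y hY

end Plots


/-! ### Linear and conjugation conditions that pass from a Zariski-dense set to the group. -/

section ZariskiDensity

open Matrix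

variable {n : ℕ} {G : Subgroup (GL (Fin n) ℝ)} {S : Set G}

/-- A point outside `W` is separated from `W` by a linear form, and a linear form of a matrix of
polynomials is again a polynomial. -/
theorem IsZariskiDense.mapMatrix_mem (hS : IsZariskiDense G S)
    (W : Submodule ℝ (Matrix (Fin n) (Fin n) ℝ))
    (M : Matrix (Fin n) (Fin n) (MvPolynomial (Fin n × Fin n) ℝ))
    (h : ∀ g ∈ S, (MvPolynomial.eval fun ij => (g : GL (Fin n) ℝ) ij.1 ij.2).mapMatrix M ∈ W)
    (g : G) : (MvPolynomial.eval fun ij => (g : GL (Fin n) ℝ) ij.1 ij.2).mapMatrix M ∈ W := by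
  by_contra hg
  obtain ⟨φ, hφ, hφW⟩ := W.exists_le_ker_of_notMem hg
  have key : ∀ x : Fin n × Fin n → ℝ, MvPolynomial.eval x
      (∑ i, ∑ j, MvPolynomial.C (φ (Matrix.single i j 1)) * M i j) =
      φ ((MvPolynomial.eval x).mapMatrix M) := by
    intro x
    conv_rhs => rw [matrix_eq_sum_single ((MvPolynomial.eval x).mapMatrix M)]
    simp only [map_sum, map_mul, MvPolynomial.eval_C]
    refine Finset.sum_congr rfl fun i _ => Finset.sum_congr rfl fun j _ => ?_
    have hsmul : single i j ((MvPolynomial.eval x).mapMatrix M i j) =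
        MvPolynomial.eval x (M i j) • single i j (1 : ℝ) := by
      simp [smul_single]
    rw [hsmul, map_smul, smul_eq_mul, mul_comm]
  refine hφ ?_
  rw [← key]
  refine hS _ (fun k hk => ?_) g
  rw [key]
  exact hφW (h k hk)

theorem IsZariskiDense.nonempty (hS : IsZariskiDense G S) : S.Nonempty := by
  by_contra h
  rw [Set.not_nonempty_iff_eq_empty] at h
  subst h
  simpa using hS 1 (by simp) 1

theorem mapMatrix_eval_mvPolynomialX (g : Matrix (Fin n) (Fin n) ℝ) :
    (MvPolynomial.eval fun ij => g ij.1 ij.2).mapMatrix (mvPolynomialX (Fin n) (Fin n) ℝ) = g := by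
  ext i j
  simp

theorem mapMatrix_eval_C (x : Fin n × Fin n → ℝ) (Y : Matrix (Fin n) (Fin n) ℝ) :
    (MvPolynomial.eval x).mapMatrix (MvPolynomial.C.mapMatrix Y) = Y := by
  ext i j
  simp

theorem IsZariskiDense.commute (hS : IsZariskiDense G S) (Y : Matrix (Fin n) (Fin n) ℝ)
    (h : ∀ g ∈ S, ((g : GL (Fin n) ℝ) : Matrix (Fin n) (Fin n) ℝ) * Y = Y * (g : GL (Fin n) ℝ))
    (g : G) :
    ((g : GL (Fin n) ℝ) : Matrix (Fin n) (Fin n) ℝ) * Y = Y * (g : GL (Fin n) ℝ) := by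
  have := hS.mapMatrix_mem ⊥ (mvPolynomialX _ _ ℝ * MvPolynomial.C.mapMatrix Y -
    MvPolynomial.C.mapMatrix Y * mvPolynomialX _ _ ℝ) (fun k hk => by
      rw [map_sub, map_mul, map_mul, mapMatrix_eval_mvPolynomialX, mapMatrix_eval_C, h k hk,
        sub_self]
      exact zero_mem _) g
  rwa [map_sub, map_mul, map_mul, mapMatrix_eval_mvPolynomialX, mapMatrix_eval_C,
    Submodule.mem_bot, sub_eq_zero] at this

/-- The inverse and the adjugate differ by a nonzero scalar, which a subspace does not see; the
adjugate is polynomial in the entries. -/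
theorem conj_mem_iff_mul_adjugate_mem (W : Submodule ℝ (Matrix (Fin n) (Fin n) ℝ))
    (X : Matrix (Fin n) (Fin n) ℝ) (g : GL (Fin n) ℝ) :
    (g : Matrix (Fin n) (Fin n) ℝ) * X * ((g⁻¹ : GL (Fin n) ℝ) : Matrix (Fin n) (Fin n) ℝ) ∈ W ↔
      (g : Matrix (Fin n) (Fin n) ℝ) * X * adjugate (g : Matrix (Fin n) (Fin n) ℝ) ∈ W := by
  have hdet : (g : Matrix (Fin n) (Fin n) ℝ).det ≠ 0 := g.det_ne_zero
  rw [coe_units_inv, inv_def, Ring.inverse_eq_inv', mul_smul_comm]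
  exact W.smul_mem_iff (inv_ne_zero hdet)

theorem IsZariskiDense.conj_mem (hS : IsZariskiDense G S)
    (W : Submodule ℝ (Matrix (Fin n) (Fin n) ℝ)) (X : Matrix (Fin n) (Fin n) ℝ)
    (g₀ : GL (Fin n) ℝ)
    (h : ∀ g ∈ S, ((g₀ * g : GL (Fin n) ℝ) : Matrix (Fin n) (Fin n) ℝ) * X *
      (((g₀ * g)⁻¹ : GL (Fin n) ℝ) : Matrix (Fin n) (Fin n) ℝ) ∈ W) (g : G) :
    ((g₀ * g : GL (Fin n) ℝ) : Matrix (Fin n) (Fin n) ℝ) * X *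
      (((g₀ * g)⁻¹ : GL (Fin n) ℝ) : Matrix (Fin n) (Fin n) ℝ) ∈ W := by
  set M : Matrix (Fin n) (Fin n) (MvPolynomial (Fin n × Fin n) ℝ) :=
    MvPolynomial.C.mapMatrix (g₀ : Matrix (Fin n) (Fin n) ℝ) * mvPolynomialX _ _ ℝ
  have key : ∀ k : G, (MvPolynomial.eval fun ij => (k : GL (Fin n) ℝ) ij.1 ij.2).mapMatrix
      (M * MvPolynomial.C.mapMatrix X * adjugate M) ∈ W ↔
      ((g₀ * k : GL (Fin n) ℝ) : Matrix (Fin n) (Fin n) ℝ) * X *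
      (((g₀ * k)⁻¹ : GL (Fin n) ℝ) : Matrix (Fin n) (Fin n) ℝ) ∈ W := by
    intro k
    rw [conj_mem_iff_mul_adjugate_mem, map_mul, map_mul, RingHom.map_adjugate, map_mul,
      mapMatrix_eval_mvPolynomialX, mapMatrix_eval_C, mapMatrix_eval_C, Units.val_mul]
  rw [← key]
  exact hS.mapMatrix_mem W _ (fun k hk => (key k).2 (h k hk)) g

end ZariskiDensity


/-! ### Ideals of the semisimple Lie algebra with a Zariski-dense set controlling the commutant. -/

section SemisimpleIdeals

attribute [local instance 100] LieRing.ofAssociativeRing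

variable {n : ℕ} {G : Subgroup (GL (Fin n) ℝ)} {S : Set G}

/-- If `S` is Zariski-dense in `G` and an ideal of the semisimple Lie algebra of `G` has the property
that every tangent vector commuting with it commutes with `S`, then the ideal is everything. -/
theorem IsZariskiDense.eq_top_of_lieIdeal [Nonempty (Fin n)] (hS : IsZariskiDense G S)
    (hG : IsClosed (G : Set (GL (Fin n) ℝ)))
    (hss : LieAlgebra.IsSemisimple ℝ (lieAlgebraOfClosedSubgroup G hG))
    (I : LieIdeal ℝ (lieAlgebraOfClosedSubgroup G hG))
    (hI : ∀ Y : Matrix (Fin n) (Fin n) ℝ,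
      (∀ X ∈ I, (X : Matrix (Fin n) (Fin n) ℝ) * Y = Y * X) →
      ∀ g ∈ S, ((g : GL (Fin n) ℝ) : Matrix (Fin n) (Fin n) ℝ) * Y = Y * (g : GL (Fin n) ℝ)) :
    I = ⊤ := by
  let _ := Matrix.linftyOpNormedRing (n := Fin n) (α := ℝ)
  let _ := Matrix.linftyOpNormedAlgebra (n := Fin n) (α := ℝ) (R := ℝ)
  obtain ⟨J, hIJ⟩ := exists_isCompl I
  have hJ : J = ⊥ := by
    rw [eq_bot_iff, ← LieAlgebra.center_eq_bot ℝ (lieAlgebraOfClosedSubgroup G hG)]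
    intro Y hY
    have hIY : ∀ X ∈ I, (X : Matrix (Fin n) (Fin n) ℝ) * Y = Y * X := by
      intro X hX
      have h0 : ⁅X, Y⁆ ∈ I ⊓ J :=
        ⟨lie_mem_left ℝ _ I X Y hX, lie_mem_right ℝ _ J X Y hY⟩
      rw [hIJ.inf_eq_bot, LieSubmodule.mem_bot] at h0
      have h1 := congrArg (Subtype.val) h0
      rwa [LieSubalgebra.coe_bracket, Ring.lie_def, ZeroMemClass.coe_zero, sub_eq_zero] at h1
    have hGY := hS.commute Y (hI Y hIY)
    rw [LieModule.mem_maxTrivSubmodule]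
    intro Z
    let C : Submodule ℝ (Matrix (Fin n) (Fin n) ℝ) :=
      { carrier := {A | A * (Y : Matrix (Fin n) (Fin n) ℝ) = Y * A}
        zero_mem' := by simp
        add_mem' := fun {A B} hA hB => by
          simp only [Set.mem_ofPred_eq] at hA hB ⊢
          rw [add_mul, mul_add, hA, hB]
        smul_mem' := fun c A hA => by
          simp only [Set.mem_ofPred_eq] at hA ⊢
          rw [smul_mul_assoc, mul_smul_comm, hA] }
    -- The commutant `C` of `Y` is a subspace containing every `exp (t Z)`, hence also their
    -- derivative `Z` at `t = 0`.
    have hZ : (Z : Matrix (Fin n) (Fin n) ℝ) ∈ C := mem_of_exp_smul_mem C fun t => by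
      obtain ⟨g, hg, hg'⟩ := Z.2 t
      have hgC : (g : Matrix (Fin n) (Fin n) ℝ) ∈ C := hGY ⟨g, hg⟩
      exact (congrArg (· ∈ C) hg').mp hgC
    refine Subtype.ext ?_
    rw [LieSubalgebra.coe_bracket, Ring.lie_def, ZeroMemClass.coe_zero, sub_eq_zero]
    exact hZ
  rw [← hIJ.sup_eq_top, hJ, sup_bot_eq]

end SemisimpleIdeals

/-! ### The half-line semigroup and the maximality argument. -/

section HalfLines

attribute [local instance 100] LieRing.ofAssociativeRing

variable {n : ℕ} {G : Subgroup (GL (Fin n) ℝ)} {s : ℕ} {γ : Fin s → (Multiplicative ℝ →ₜ* G)}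

theorem mem_halfLineSemigroup {G : Type*} [Group G] [TopologicalSpace G] {s : ℕ}
    (γ : Fin s → (Multiplicative ℝ →ₜ* G)) (j : Fin s) {t : ℝ} (ht : 1 ≤ t) :
    γ j (Multiplicative.ofAdd t) ∈ halfLineSemigroup γ :=
  Subsemigroup.subset_closure (Set.mem_iUnion.2 ⟨j, t, ht, rfl⟩)

theorem exists_eq_exp_of_oneParameter [Nonempty (Fin n)] (f : Multiplicative ℝ →ₜ* G) :
    ∃ X : Matrix (Fin n) (Fin n) ℝ, ∀ t : ℝ,
      ((f (Multiplicative.ofAdd t) : GL (Fin n) ℝ) : Matrix (Fin n) (Fin n) ℝ) =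
        NormedSpace.exp (t • X) := by
  let _ := Matrix.linftyOpNormedRing (n := Fin n) (α := ℝ)
  let _ := Matrix.linftyOpNormedAlgebra (n := Fin n) (α := ℝ) (R := ℝ)
  refine exists_eq_exp_of_map_add _ ?_ ?_ fun a b => ?_
  · exact Units.continuous_val.comp
      (continuous_subtype_val.comp (f.continuous_toFun.comp continuous_ofAdd))
  · simp
  · simp [ofAdd_add]

theorem halfLineSemigroup_commute {X : Fin s → Matrix (Fin n) (Fin n) ℝ}
    (hX : ∀ j t, ((γ j (Multiplicative.ofAdd t) : GL (Fin n) ℝ) : Matrix (Fin n) (Fin n) ℝ) =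
      NormedSpace.exp (t • X j)) {Y : Matrix (Fin n) (Fin n) ℝ}
    (hY : ∀ j, X j * Y = Y * X j) {g : G} (hg : g ∈ halfLineSemigroup γ) :
    ((g : GL (Fin n) ℝ) : Matrix (Fin n) (Fin n) ℝ) * Y = Y * (g : GL (Fin n) ℝ) := by
  let _ := Matrix.linftyOpNormedRing (n := Fin n) (α := ℝ)
  let _ := Matrix.linftyOpNormedAlgebra (n := Fin n) (α := ℝ) (R := ℝ)
  let _ := NormedAlgebra.restrictScalars ℚ ℝ (Matrix (Fin n) (Fin n) ℝ)
  induction hg using Subsemigroup.closure_induction with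
  | mem g hg =>
    obtain ⟨j, t, -, rfl⟩ := Set.mem_iUnion.1 hg
    simp only [hX]
    exact ((show Commute (X j) Y from hY j).smul_left t).exp_left
  | mul a b _ _ ha hb =>
    rw [Subgroup.coe_mul, Units.val_mul, mul_assoc, hb, ← mul_assoc, ha, mul_assoc]

theorem interior_halfLineSemigroup_nonempty [Nonempty (Fin n)]
    (hG : IsClosed (G : Set (GL (Fin n) ℝ)))
    (hss : LieAlgebra.IsSemisimple ℝ (lieAlgebraOfClosedSubgroup G hG))
    (hH : IsZariskiDense G (halfLineSemigroup γ : Set G)) :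
    (interior (halfLineSemigroup γ : Set G)).Nonempty := by
  let _ := Matrix.linftyOpNormedRing (n := Fin n) (α := ℝ)
  let _ := Matrix.linftyOpNormedAlgebra (n := Fin n) (α := ℝ) (R := ℝ)
  choose X hX using fun j => exists_eq_exp_of_oneParameter (γ j)
  set S : Set (GL (Fin n) ℝ) := Subtype.val '' (halfLineSemigroup γ : Set G) with hSdef
  have hSG : S ⊆ G := by rintro _ ⟨g, -, rfl⟩; exact g.2
  have hSmul : ∀ a ∈ S, ∀ b ∈ S, a * b ∈ S := by
    rintro _ ⟨a, ha, rfl⟩ _ ⟨b, hb, rfl⟩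
    exact ⟨a * b, mul_mem ha hb, rfl⟩
  have hSexp : ∀ j, ∀ t : ℝ, 1 ≤ t → ((γ j (Multiplicative.ofAdd t) : G) : GL (Fin n) ℝ) ∈ S :=
    fun j t ht => ⟨_, mem_halfLineSemigroup γ j ht, rfl⟩
  obtain ⟨g, W, hW, hmax⟩ : ∃ (g : GL (Fin n) ℝ)
      (W : Submodule ℝ (Matrix (Fin n) (Fin n) ℝ)), IsTangentAt S g W ∧
      ∀ g' W', IsTangentAt S g' W' → Module.finrank ℝ W' ≤ Module.finrank ℝ W := by
    obtain ⟨h₀, hh₀⟩ := hH.nonempty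
    classical
    let P : ℕ → Prop := fun d => ∃ (g : GL (Fin n) ℝ)
      (W : Submodule ℝ (Matrix (Fin n) (Fin n) ℝ)), IsTangentAt S g W ∧ Module.finrank ℝ W = d
    have hle : ∀ d, P d → d ≤ Module.finrank ℝ (Matrix (Fin n) (Fin n) ℝ) := by
      rintro _ ⟨_, W, _, rfl⟩
      exact W.finrank_le
    have hP : P _ := ⟨_, _, IsTangentAt.bot ⟨h₀, hh₀, rfl⟩, rfl⟩
    obtain ⟨g, W, hW, hd⟩ := Nat.findGreatest_spec (hle _ hP) hP
    exact ⟨g, W, hW, fun g' W' hW' => hd ▸ Nat.le_findGreatest (hle _ ⟨g', W', hW', rfl⟩)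
      ⟨g', W', hW', rfl⟩⟩
  have hgG : g ∈ G := hSG hW.mem
  have hconjS : ∀ j, ∀ h ∈ (halfLineSemigroup γ : Set G),
      ((g * h : GL (Fin n) ℝ) : Matrix (Fin n) (Fin n) ℝ) * X j *
        (((g * h)⁻¹ : GL (Fin n) ℝ) : Matrix (Fin n) (Fin n) ℝ) ∈ W := by
    intro j h hh
    -- Any parameter interior to `[1, ∞)` would do: `t` must be free to move in both directions.
    have hlt : ∀ᶠ t : ℝ in 𝓝 2, 1 ≤ t := eventually_ge_nhds one_lt_two
    have h1 := (hW.mul_right hSmul ⟨h, hh, rfl⟩).mul_exp hSmul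
      (hlt.mono fun t ht => ⟨_, hSexp j t ht, hX j t⟩) (hX j 2)
    have h2 := Submodule.eq_of_le_of_finrank_le le_sup_left (hmax _ _ h1)
    rw [h2]
    exact Submodule.mem_sup_right (Submodule.mem_span_singleton_self _)
  have hconj : ∀ j, ∀ h ∈ G, (h : Matrix (Fin n) (Fin n) ℝ) * X j *
      ((h⁻¹ : GL (Fin n) ℝ) : Matrix (Fin n) (Fin n) ℝ) ∈ W := by
    intro j h hh
    -- Density extends the condition from `g * H` to `g * G`, which is `G`.
    simpa using hH.conj_mem W (X j) g (hconjS j) ⟨g⁻¹ * h, G.mul_mem (G.inv_mem hgG) hh⟩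
  let U : Submodule ℝ (Matrix (Fin n) (Fin n) ℝ) :=
    { carrier := {Y | ∀ h ∈ G, (h : Matrix (Fin n) (Fin n) ℝ) * Y *
        ((h⁻¹ : GL (Fin n) ℝ) : Matrix (Fin n) (Fin n) ℝ) ∈ W}
      zero_mem' := fun h _ => by simp
      add_mem' := fun hA hB h hh => by
        rw [mul_add, add_mul]
        exact W.add_mem (hA h hh) (hB h hh)
      smul_mem' := fun c A hA h hh => by
        rw [mul_smul_comm, smul_mul_assoc]
        exact W.smul_mem c (hA h hh) }
  have hU : ∀ k ∈ G, ∀ Y ∈ U, (k : Matrix (Fin n) (Fin n) ℝ) * Y *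
      ((k⁻¹ : GL (Fin n) ℝ) : Matrix (Fin n) (Fin n) ℝ) ∈ U := by
    intro k hk Y hY h hh
    have := hY (h * k) (G.mul_mem hh hk)
    rw [mul_inv_rev, Units.val_mul, Units.val_mul] at this
    simpa only [mul_assoc] using this
  -- `U` is the largest conjugation-invariant subspace inside `W`; differentiating the invariance
  -- makes its trace on the Lie algebra an ideal.
  let I : LieIdeal ℝ (lieAlgebraOfClosedSubgroup G hG) :=
    { U.comap (lieAlgebraOfClosedSubgroup G hG).toSubmodule.subtype with
      lie_mem := fun {Z Y} hY => lie_mem_of_conj_mem G U hU Z.2 hY }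
  have hXG : ∀ j, X j ∈ lieAlgebraOfClosedSubgroup G hG := fun j t => ⟨_, (γ j _).2, hX j t⟩
  have hItop : I = ⊤ := by
    refine hH.eq_top_of_lieIdeal hG hss I fun Y hY k hk => ?_
    exact halfLineSemigroup_commute hX (fun j => hY ⟨X j, hXG j⟩ (hconj j)) hk
  have hVW : (lieAlgebraOfClosedSubgroup G hG).toSubmodule ≤ W := by
    intro Z hZ
    have hZI : (⟨Z, hZ⟩ : lieAlgebraOfClosedSubgroup G hG) ∈ I := hItop ▸ LieSubmodule.mem_top _
    have hZU : Z ∈ U := hZI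
    simpa using hZU 1 G.one_mem
  have hopen := hW.eventually_mem G hG hSG (lieAlgebraOfClosedSubgroup G hG).toSubmodule rfl hVW
  refine ⟨⟨g, hgG⟩, mem_interior_iff_mem_nhds.2 ?_⟩
  filter_upwards [(continuous_subtype_val.tendsto (⟨g, hgG⟩ : G)).eventually hopen] with x hx
  obtain ⟨y, hy, hyx⟩ := hx x.2
  rwa [← Subtype.ext hyx]

end HalfLines

theorem mainTheorem11 (n : ℕ) (G : Subgroup (Matrix.GeneralLinearGroup (Fin n) ℝ))
    (hG : IsClosed (G : Set (Matrix.GeneralLinearGroup (Fin n) ℝ)))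
    (hss : LieAlgebra.IsSemisimple ℝ (lieAlgebraOfClosedSubgroup G hG))
    (s : ℕ) (γ : Fin s → (Multiplicative ℝ →ₜ* G))
    (hH : IsZariskiDense G (halfLineSemigroup γ : Set G)) :
    (interior (halfLineSemigroup γ : Set G)).Nonempty := by
  rcases isEmpty_or_nonempty (Fin n) with h | h
  · rw [Set.Nonempty.eq_univ hH.nonempty, interior_univ]
    exact Set.univ_nonempty
  · exact interior_halfLineSemigroup_nonempty hG hss hH
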